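/- Let $\Sigma$ be an alphabet and $a\in\Sigma$; write $a^+ := a\cdot a^*$. A regular graph pattern (RGP) $P$ over $\Sigma$ is a digraph $D_P$ together with a function $E_P$ assigning to each arc a regular expression over $\Sigma$. The label $E_P(W)$ of a directed walk $W$ is the concatenation of the labels of its arcs. An n-homomorphism from an RGP $P$ to an RGP $Q$ is a map $f:V(D_P)\to V(D_Q)$ such that for each arc $(x,y)$ of $D_P$ there is a directed walk $W$ in $Q$ from $f(x)$ to $f(y)$ with $L(E_Q(W))\subseteq L(E_P(x,y))$. Theorem. Let $Q$ be a fixed RGP whose underlying digraph is a directed path (its vertices can be listed without repetition as $q_0,\dots,q_n$, $n\ge 0$, so that its arcs are exactly $(q_i,q_{i+1})$ for $0\le i<n$) and all of whose arc labels are $a$ or $a^+$. Then the following problem, RGPHom$(Q)$ for instances with arc labels in $\{a,a^+\}$, is solvable in polynomial time: given a finite RGP $P$ with all arc labels in $\{a,a^+\}$ (encoded by its labelled adjacency matrix), decide whether $P$ admits an n-homomorphism to $Q$. -/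

import Mathlib

/-- A regular graph pattern over the alphabet `α` with vertex set `V`: a digraph (loops allowed)
together with an arc-label function to regular expressions.  `label x y = none` means that there is
no arc from `x` to `y`, and `label x y = some E` that there is one, labelled `E`. -/
structure RGP (α V : Type) where
  label : V → V → Option (RegularExpression α)

namespace RGP

variable {α V W : Type}

/-- The underlying digraph. -/
def graph (P : RGP α V) : Digraph V where
  Adj x y := (P.label x y).isSome = true

/-- Directed walks from one vertex to another: sequences of consecutive arcs. -/
inductive Walk (P : RGP α V) : V → V → Type
  | nil (x : V) : Walk P x x
  | cons {x y z : V} (E : RegularExpression α) (h : P.label x y = some E) (w : Walk P y z) :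
      Walk P x z

/-- The label of a walk: the concatenation of the labels of its arcs. -/
def Walk.label {P : RGP α V} {x y : V} : P.Walk x y → RegularExpression α
  | .nil _ => 1
  | .cons E _ w => E * w.label

/-- `f` is a navigational homomorphism of `P` to `Q`. -/
def IsNHom (P : RGP α V) (Q : RGP α W) (f : V → W) : Prop :=
  ∀ (x y : V) (E : RegularExpression α), P.label x y = some E →
    ∃ w : Q.Walk (f x) (f y), w.label.matches' ≤ E.matches'

/-- `P` admits an n-homomorphism to `Q`. -/
def NHom (P : RGP α V) (Q : RGP α W) : Prop :=
  ∃ f : V → W, IsNHom P Q f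

/-- All arc labels are the expression `a` or the expression `a⁺ = a · a*`. -/
def LabelsAAPlus (a : α) (P : RGP α V) : Prop :=
  ∀ (x y : V) (E : RegularExpression α), P.label x y = some E →
    E = RegularExpression.char a ∨
      E = RegularExpression.char a * RegularExpression.star (RegularExpression.char a)

end RGP

/-- A digraph is a directed path if its vertices can be listed without repetition as
`q 0, …, q n` so that its arcs are exactly `(q i, q (i + 1))` for `i < n`. -/
def Digraph.IsDirectedPath {V : Type} (D : Digraph V) : Prop :=
  ∃ (n : ℕ) (q : Fin (n + 1) ≃ V),
    ∀ i j : Fin (n + 1), D.Adj (q i) (q j) ↔ (i : ℕ) + 1 = (j : ℕ)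

/-- An input: a finite regular graph pattern on the vertices `0, …, n - 1` with arc labels in
`{a, a⁺}`. -/
structure AAPlusInstance {α : Type} (a : α) where
  n : ℕ
  rgp : RGP α (Fin n)
  labels : rgp.LabelsAAPlus a

/-- The tape alphabet for inputs. -/
inductive MatSym : Type
  | noArc
  | arcA
  | arcAPlus
  | endRow
  deriving DecidableEq

namespace AAPlusInstance

variable {α : Type} {a : α}

open Classical in
/-- The entry of the labelled adjacency matrix at `(x, y)`. -/
noncomputable def entry (P : AAPlusInstance a) (x y : Fin P.n) : MatSym :=
  if P.rgp.label x y = none then .noArc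
  else if P.rgp.label x y = some (RegularExpression.char a) then .arcA
  else .arcAPlus

/-- The labelled adjacency matrix written row by row, with a marker at the end of each row. -/
noncomputable def encode (P : AAPlusInstance a) : List MatSym :=
  (List.finRange P.n).flatMap fun x =>
    (List.finRange P.n).map (fun y => P.entry x y) ++ [MatSym.endRow]

/-- Different inputs have different encodings. -/
theorem encode_injective : Function.Injective (encode (a := a)) := by
  classical
  have hne : ∀ (P : AAPlusInstance a) (x y : Fin P.n), P.entry x y ≠ MatSym.endRow := by
    intro P x y
    unfold entry
    split_ifs <;> simp
  have hcount : ∀ P : AAPlusInstance a, P.encode.count MatSym.endRow = P.n := by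
    intro P
    have h0 : ∀ x : Fin P.n, ((List.finRange P.n).map fun y => P.entry x y).count
        MatSym.endRow = 0 := by
      intro x
      rw [List.count_eq_zero]
      simp [hne]
    have h1 : ∀ l : List (Fin P.n), (l.flatMap fun x =>
        (List.finRange P.n).map (fun y => P.entry x y) ++ [MatSym.endRow]).count
          MatSym.endRow = l.length := by
      intro l
      induction l with
      | nil => rfl
      | cons x l ih =>
        rw [List.flatMap_cons, List.count_append, List.count_append, h0, ih]
        simp [Nat.add_comm]
    simpa [encode] using h1 (List.finRange P.n)
  have hblock : ∀ {ι : Type} (l : List ι) (f g : ι → List MatSym),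
      (∀ i, (f i).length = (g i).length) → l.flatMap f = l.flatMap g → ∀ i ∈ l, f i = g i := by
    intro ι l f g hlen
    induction l with
    | nil => simp
    | cons x l ih =>
      intro h
      rw [List.flatMap_cons, List.flatMap_cons] at h
      obtain ⟨h1, h2⟩ := List.append_inj h (hlen x)
      intro i hi
      rcases List.mem_cons.1 hi with rfl | hi
      · exact h1
      · exact ih h2 i hi
  rintro P P' h
  have hn : P.n = P'.n := by rw [← hcount P, ← hcount P', h]
  obtain ⟨n, P, hP⟩ := P
  obtain ⟨n', P', hP'⟩ := P'
  dsimp only at hn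
  subst hn
  have hrow := hblock _ _ _ (by intro i; simp) h
  have hentry : ∀ x y, entry ⟨n, P, hP⟩ x y = entry ⟨n, P', hP'⟩ x y := by
    intro x y
    have h1 := List.append_cancel_right (hrow x (List.mem_finRange x))
    exact List.map_inj_left.1 h1 y (List.mem_finRange y)
  have hsemi : RegularExpression.char a ≠
      RegularExpression.char a * RegularExpression.star (RegularExpression.char a) := by
    intro h
    cases h
  have hlab : P.label = P'.label := by
    funext x y
    have h1 := hentry x y
    have h2 := hP x y
    have h3 := hP' x y
    unfold entry at h1
    dsimp only at h1
    rcases hl : P.label x y with _ | E <;> rcases hl' : P'.label x y with _ | E' <;>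
      simp only [hl, hl'] at h1 h2 h3 ⊢
    · rcases h3 E' rfl with rfl | rfl <;> simp [hsemi.symm] at h1
    · rcases h2 E rfl with rfl | rfl <;> simp [hsemi.symm] at h1
    · rcases h2 E rfl with rfl | rfl <;> rcases h3 E' rfl with rfl | rfl
      · rfl
      · simp [hsemi.symm] at h1
      · simp [hsemi.symm] at h1
      · rfl
  cases P
  cases P'
  cases hlab
  rfl

end AAPlusInstance

/-- The decision problem `prob`, with inputs written as strings through `enc`, is solvable in
polynomial time: a Turing machine computes its answer in a number of steps bounded by a polynomial
in the length of the input string. -/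
def SolvableInPolyTime {I Γ : Type} (enc : I → List Γ) (prob : I → Prop) : Prop :=
  ∃ f : I → Bool, (∀ x, f x = true ↔ prob x) ∧
    Nonempty (Turing.TM2ComputableInPolyTime enc Computability.encodeBool f)

/-! Number the vertices of the path by `0, …, n`. All walks between two given positions have the
same length, and every arc label contains the word `a`. So an `a`-arc of `P` must be mapped onto a
single arc of `Q` labelled `a`, while an `a⁺`-arc only forces a strict increase of position
(`exists_walk_char_iff`, `exists_walk_charPlus_iff`, `nHom_iff`). These constraints are preserved by
pointwise minima, so a least solution exists as soon as there is a solution, and propagating lower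
bounds finds it.

Each constraint becomes a monotone inflationary map `raise` on pairs of bounds in `{0, …, n + 1}`,
the top value meaning failure. Below the top, its fixed pairs are exactly the pairs satisfying the
constraint. Iteration from `0` reaches the least common fixed point `v`; if `v` avoids `n + 1` it is
a solution, and any solution is a fixed point, hence lies above `v` and keeps it below `n + 1`
(`all_lt_last_iff_nHom`).

For the time bound, a sweep over the matrix that changes anything strictly raises the sum of the
bounds (`sweep_progress`), and this sum is linear in the number of vertices because `n` is fixed. A
sweep takes linearly many steps on a stack machine that reads each row in parallel with the list of
bounds (`reach_sweep`, `reach_answer`). -/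

/-! ### Propagation of lower bounds -/

namespace Propagation

variable {ι S D : Type} [DecidableEq ι] [LinearOrder D]

/-- Process the entry `(x, y)`.  The state consists of a flag recording changes, the current value
at the row vertex `x`, and the current values at all vertices. -/
def scanStep (rev : S → D × D → D × D) (s : ι → ι → S) (x : ι) (b : Bool × D × (ι → D)) (y : ι) :
    Bool × D × (ι → D) :=
  (b.1 || !decide (rev (s x y) (b.2.1, b.2.2 y) = (b.2.1, b.2.2 y)),
    (rev (s x y) (b.2.1, b.2.2 y)).1,
    Function.update b.2.2 y (rev (s x y) (b.2.1, b.2.2 y)).2)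

/-- Process the row of `x`. -/
def rowStep (rev : S → D × D → D × D) (s : ι → ι → S) (l : List ι) (b : Bool × (ι → D)) (x : ι) :
    Bool × (ι → D) :=
  let b' := l.foldl (scanStep rev s x) (b.1, b.2 x, b.2)
  -- During the scan the bound at `x` lives both in the running row value and in column `x`. The two
  -- copies may differ, so their maximum is kept.
  (b'.1, Function.update b'.2.2 x (max (b'.2.2 x) b'.2.1))

/-- Process all rows. -/
def sweep (rev : S → D × D → D × D) (s : ι → ι → S) (l : List ι) (v : ι → D) : Bool × (ι → D) :=
  l.foldl (rowStep rev s l) (false, v)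

variable {rev : S → D × D → D × D} {s : ι → ι → S}

/-! ### Sweeps stay below every common fixed point -/

section UpperBound

variable (hmono : ∀ c, Monotone (rev c)) {g : ι → D}
  (hg : ∀ x y, rev (s x y) (g x, g y) = (g x, g y))
include hmono hg

/-- By monotonicity a pair below `(g x, g y)` is sent below the image of `(g x, g y)`, which is that
pair itself. -/
theorem scan_le (x : ι) (l : List ι) : ∀ (b : Bool × D × (ι → D)), b.2.1 ≤ g x → b.2.2 ≤ g →
    (l.foldl (scanStep rev s x) b).2.1 ≤ g x ∧ (l.foldl (scanStep rev s x) b).2.2 ≤ g := by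
  induction l with
  | nil => exact fun b h1 h2 => ⟨h1, h2⟩
  | cons y l ih =>
    intro b h1 h2
    have h := hmono (s x y) (show (b.2.1, b.2.2 y) ≤ (g x, g y) from ⟨h1, h2 y⟩)
    rw [hg] at h
    exact ih _ h.1 (update_le_iff.2 ⟨h.2, fun z _ => h2 z⟩)

theorem rowStep_le (l : List ι) (b : Bool × (ι → D)) (x : ι) (h : b.2 ≤ g) :
    (rowStep rev s l b x).2 ≤ g := by
  obtain ⟨h1, h2⟩ := scan_le hmono hg x l (b.1, b.2 x, b.2) (h x) h
  exact update_le_iff.2 ⟨max_le (h2 x) h1, fun z _ => h2 z⟩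

theorem sweep_le (l : List ι) (v : ι → D) (h : v ≤ g) : (sweep rev s l v).2 ≤ g := by
  have key : ∀ (l' : List ι) (b : Bool × (ι → D)), b.2 ≤ g →
      (l'.foldl (rowStep rev s l) b).2 ≤ g := by
    intro l'
    induction l' with
    | nil => exact fun b h => h
    | cons x l' ih => exact fun b h => ih _ (rowStep_le hmono hg l b x h)
  exact key l _ h

end UpperBound

/-! ### A sweep without changes certifies a fixed point -/

/-- The flag is never lowered. If it ends low, no step moved the state, so every test was made
against the starting values. -/
theorem scan_flag (x : ι) (l : List ι) : ∀ (b : Bool × D × (ι → D)),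
    (l.foldl (scanStep rev s x) b).1 = false →
    l.foldl (scanStep rev s x) b = b ∧ b.1 = false ∧
      ∀ y ∈ l, rev (s x y) (b.2.1, b.2.2 y) = (b.2.1, b.2.2 y) := by
  induction l with
  | nil => exact fun b h => ⟨rfl, h, by simp⟩
  | cons y l ih =>
    intro b h
    obtain ⟨h1, h2, h3⟩ := ih _ h
    simp only [scanStep, Bool.or_eq_false_iff, Bool.not_eq_false', decide_eq_true_eq] at h2
    have hb : scanStep rev s x b y = b := by
      simp only [scanStep, h2.2, h2.1]
      ext <;> simp [h2.1]
    rw [hb] at h1 h3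
    rw [List.foldl_cons, hb]
    exact ⟨h1, h2.1, by simpa [h2.2] using h3⟩

theorem rowStep_flag (l : List ι) (b : Bool × (ι → D)) (x : ι)
    (h : (rowStep rev s l b x).1 = false) :
    rowStep rev s l b x = b ∧ b.1 = false ∧
      ∀ y ∈ l, rev (s x y) (b.2 x, b.2 y) = (b.2 x, b.2 y) := by
  obtain ⟨h1, h2, h3⟩ := scan_flag x l _ h
  refine ⟨?_, h2, h3⟩
  simp only [rowStep, h1]
  ext <;> simp

theorem sweep_flag (l : List ι) (v : ι → D) (h : (sweep rev s l v).1 = false) :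
    (sweep rev s l v).2 = v ∧
      ∀ x ∈ l, ∀ y ∈ l, rev (s x y) (v x, v y) = (v x, v y) := by
  have key : ∀ (l' : List ι) (b : Bool × (ι → D)),
      (l'.foldl (rowStep rev s l) b).1 = false →
      l'.foldl (rowStep rev s l) b = b ∧ b.1 = false ∧
        ∀ x ∈ l', ∀ y ∈ l, rev (s x y) (b.2 x, b.2 y) = (b.2 x, b.2 y) := by
    intro l'
    induction l' with
    | nil => exact fun b h => ⟨rfl, h, by simp⟩
    | cons x l' ih =>
      intro b h
      obtain ⟨h1, h2, h3⟩ := ih _ h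
      obtain ⟨h4, h5, h6⟩ := rowStep_flag l b x h2
      rw [h4] at h1 h3
      rw [List.foldl_cons, h4]
      refine ⟨h1, h5, ?_⟩
      simpa using ⟨h6, h3⟩
  obtain ⟨h1, -, h3⟩ := key l _ h
  exact ⟨congrArg Prod.snd h1, h3⟩

/-! ### A sweep with changes makes strict progress -/

section Progress

variable (hext : ∀ c p, p ≤ rev c p)
include hext

/-- Progress is measured on the merged vector that `rowStep` returns, since a change may show only
in the running row value. When the flag is first raised, equality of the merged vector with `v`
would squeeze both coordinates of the revised pair to their old values, so nothing would have
changed. -/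
theorem scan_progress (x : ι) (v : ι → D) (l : List ι) : ∀ (b : Bool × D × (ι → D)),
    v x ≤ b.2.1 → v ≤ b.2.2 →
    (b.1 = true → v < Function.update b.2.2 x (max (b.2.2 x) b.2.1)) →
    let b' := l.foldl (scanStep rev s x) b
    v ≤ Function.update b'.2.2 x (max (b'.2.2 x) b'.2.1) ∧
      (b'.1 = true → v < Function.update b'.2.2 x (max (b'.2.2 x) b'.2.1)) := by
  induction l with
  | nil =>
    exact fun b h1 h2 h3 =>
      ⟨le_update_iff.2 ⟨(h2 x).trans (le_max_left _ _), fun z _ => h2 z⟩, h3⟩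
  | cons y l ih =>
    intro b h1 h2 h3
    have hp := hext (s x y) (b.2.1, b.2.2 y)
    have hp1 : b.2.1 ≤ (rev (s x y) (b.2.1, b.2.2 y)).1 := hp.1
    have hp2 : b.2.2 y ≤ (rev (s x y) (b.2.1, b.2.2 y)).2 := hp.2
    have hle : b.2.2 ≤ (scanStep rev s x b y).2.2 :=
      le_update_iff.2 ⟨hp2, fun z _ => le_rfl⟩
    have hle' : v ≤ (scanStep rev s x b y).2.2 := h2.trans hle
    have hw : b.2.1 ≤ (scanStep rev s x b y).2.1 := hp1
    refine ih _ (h1.trans hp1) hle' ?_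
    intro hflag
    have hv : v ≤ Function.update (scanStep rev s x b y).2.2 x
        (max ((scanStep rev s x b y).2.2 x) (scanStep rev s x b y).2.1) :=
      le_update_iff.2 ⟨(hle' x).trans (le_max_left _ _), fun z _ => hle' z⟩
    by_cases hb : b.1 = true
    · refine (h3 hb).trans_le (update_le_update_iff.2 ⟨?_, fun z _ => hle z⟩)
      exact max_le_max (hle x) hw
    · simp only [scanStep, hb, Bool.false_or, Bool.not_eq_true', decide_eq_false_iff_not] at hflag
      refine lt_of_le_of_ne hv fun heq => hflag ?_
      have hx := congrFun heq x
      rw [Function.update_self] at hx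
      have h4 : (scanStep rev s x b y).2.1 = b.2.1 :=
        le_antisymm (((le_max_right _ _).trans hx.ge).trans h1) hw
      have h5 : (scanStep rev s x b y).2.2 y ≤ b.2.2 y := by
        refine le_trans ?_ (h2 y)
        by_cases hyx : y = x
        · subst hyx; exact (le_max_left _ _).trans hx.ge
        · have := congrFun heq y
          rw [Function.update_of_ne hyx] at this
          exact this.ge
      simp only [scanStep, Function.update_self] at h4 h5
      exact Prod.ext h4 (le_antisymm h5 hp2)

theorem rowStep_progress (l : List ι) (b : Bool × (ι → D)) (x : ι) (v : ι → D) (h : v ≤ b.2)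
    (hb : b.1 = true → v < b.2) :
    v ≤ (rowStep rev s l b x).2 ∧ ((rowStep rev s l b x).1 = true → v < (rowStep rev s l b x).2) := by
  by_cases hb1 : b.1 = true
  · have := (scan_progress (s := s) hext x b.2 l (false, b.2 x, b.2) le_rfl le_rfl (by simp)).1
    -- The values do not depend on the flag, so the scan can be compared with one started from a low
    -- flag, for which the last hypothesis of `scan_progress` is vacuous.
    have h2 : ∀ (l : List ι) (c c' : Bool × D × (ι → D)), c.2 = c'.2 →
        (l.foldl (scanStep rev s x) c).2 = (l.foldl (scanStep rev s x) c').2 := by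
      intro l
      induction l with
      | nil => exact fun _ _ h => h
      | cons y l ih => exact fun c c' h => ih _ _ (by simp [scanStep, h])
    have h3 : b.2 ≤ (rowStep rev s l b x).2 := by
      simp only [rowStep]
      rw [h2 l (b.1, b.2 x, b.2) (false, b.2 x, b.2) rfl]
      exact this
    exact ⟨h.trans h3, fun _ => (hb hb1).trans_le h3⟩
  · have := scan_progress (s := s) hext x b.2 l (b.1, b.2 x, b.2) le_rfl le_rfl (by simp [hb1])
    exact ⟨h.trans this.1, fun hc => h.trans_lt (this.2 hc)⟩

theorem sweep_progress (l : List ι) (v : ι → D) (h : (sweep rev s l v).1 = true) :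
    v < (sweep rev s l v).2 := by
  have key : ∀ (l' : List ι) (b : Bool × (ι → D)), v ≤ b.2 → (b.1 = true → v < b.2) →
      (l'.foldl (rowStep rev s l) b).1 = true → v < (l'.foldl (rowStep rev s l) b).2 := by
    intro l'
    induction l' with
    | nil => exact fun b _ h => h
    | cons x l' ih =>
      intro b h1 h2
      obtain ⟨h3, h4⟩ := rowStep_progress (s := s) hext l b x v h1 h2
      exact ih _ h3 h4
  exact key l _ le_rfl (by simp) h

end Progress

end Propagation

/-! ### A stack machine performing the propagation -/

instance : Fintype MatSym :=
  ⟨{.noArc, .arcA, .arcAPlus, .endRow}, fun x => by cases x <;> simp⟩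

namespace PropagationMachine

open Turing StateTransition Propagation

/-- The stacks: unread part of the matrix, part already read (reversed), unread part of the list of
values, part already read (reversed), output. -/
inductive Stack : Type
  | inp
  | mat
  | vals
  | valsRead
  | out
  deriving DecidableEq

/-- Whether the row of a vertex has been processed, is being processed, or is still to be
processed. -/
inductive Status : Type
  | done
  | cur
  | todo
  deriving DecidableEq

/-- The program labels. -/
inductive Lbl : Type
  | init
  | rewMat
  | rewVals
  | scan
  | reset
  | clearMat
  | clearVals
  deriving DecidableEq

instance : Fintype Stack :=
  ⟨{.inp, .mat, .vals, .valsRead, .out}, fun x => by cases x <;> simp⟩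

instance : Fintype Status :=
  ⟨{.done, .cur, .todo}, fun x => by cases x <;> simp⟩

instance : Fintype Lbl :=
  ⟨{.init, .rewMat, .rewVals, .scan, .reset, .clearMat, .clearVals}, fun x => by cases x <;> simp⟩

/-- The registers. -/
structure Reg (D : Type) where
  sym : Option MatSym
  elt : Option (D × Status)
  rowVal : D
  nextVal : D
  changed : Bool
  seen : Bool
  ok : Bool

noncomputable instance {D : Type} [Fintype D] : Fintype (Reg D) :=
  Fintype.ofInjective
    (fun ρ : Reg D => (ρ.sym, ρ.elt, ρ.rowVal, ρ.nextVal, ρ.changed, ρ.seen, ρ.ok))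
    (by rintro ⟨⟩ ⟨⟩ h; simpa using h)

/-- The stack alphabets. -/
abbrev Alph (D : Type) : Stack → Type
  | .inp => MatSym
  | .mat => MatSym
  | .vals => D × Status
  | .valsRead => D × Status
  | .out => Bool

variable {D : Type}

/-- The initial registers. -/
def initReg (d₀ : D) : Reg D := ⟨none, none, d₀, d₀, false, false, true⟩

/-- Read an element of the list of values while rewinding it. -/
def rewReg [LinearOrder D] (ρ : Reg D) : Option (D × Status) → Reg D
  | none => { ρ with elt := none }
  -- Rewinding runs from the last vertex to the first, so the final `nextVal` belongs to the first
  -- unprocessed vertex.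
  | some (v, .todo) => { ρ with elt := some (v, .todo), nextVal := v }
  | some (v, .cur) => { ρ with elt := some (max v ρ.rowVal, .done) }
  | some (v, .done) => { ρ with elt := some (v, .done) }

/-- Read an element of the list of values in parallel with a matrix entry. -/
def scanReg [LinearOrder D] (rev : MatSym → D × D → D × D) (d₀ : D) (ρ : Reg D)
    (o : Option (D × Status)) : Reg D :=
  let e := o.getD (d₀, .done)
  let p := rev (ρ.sym.getD .noArc) (ρ.rowVal, e.1)
  { ρ with
    elt := some (p.2, if e.2 = .todo ∧ ρ.seen = false then .cur else e.2)
    rowVal := p.1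
    changed := ρ.changed || !decide (p = (ρ.rowVal, e.1))
    seen := ρ.seen || decide (e.2 = .todo) }

open TM2.Stmt in
/-- Clear the reading registers and jump. -/
def jump (l : Lbl) : TM2.Stmt (Alph D) Lbl (Reg D) :=
  load (fun ρ => { ρ with sym := none, elt := none }) (goto fun _ => l)

open TM2.Stmt in
/-- The program. -/
def prog [LinearOrder D] (rev : MatSym → D × D → D × D) (d₀ : D) (bad : D → Bool) :
    Lbl → TM2.Stmt (Alph D) Lbl (Reg D)
  | .init =>
    pop .inp (fun ρ o => { ρ with sym := o }) <|
      branch (fun ρ => ρ.sym.isSome)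
        (push .mat (fun ρ => ρ.sym.getD .noArc) <|
          branch (fun ρ => decide (ρ.sym = some .endRow))
            -- There is one end marker per row, hence one initial bound per vertex.
            (push .valsRead (fun _ => (d₀, .todo)) (jump .init))
            (jump .init))
        (jump .rewMat)
  | .rewMat =>
    pop .mat (fun ρ o => { ρ with sym := o }) <|
      branch (fun ρ => ρ.sym.isSome)
        (push .inp (fun ρ => ρ.sym.getD .noArc) (jump .rewMat))
        (jump .rewVals)
  | .rewVals =>
    pop .valsRead rewReg <|
      branch (fun ρ => ρ.elt.isSome)
        (push .vals (fun ρ => ρ.elt.getD (d₀, .done)) (jump .rewVals))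
        (load (fun ρ => { ρ with rowVal := ρ.nextVal, seen := false }) (jump .scan))
  | .scan =>
    pop .inp (fun ρ o => { ρ with sym := o }) <|
      branch (fun ρ => ρ.sym.isSome)
        (branch (fun ρ => decide (ρ.sym = some .endRow))
          (push .mat (fun ρ => ρ.sym.getD .noArc) (jump .rewVals))
          (pop .vals (scanReg rev d₀) <|
            push .mat (fun ρ => ρ.sym.getD .noArc) <|
            push .valsRead (fun ρ => ρ.elt.getD (d₀, .done)) (jump .scan)))
        (branch (fun ρ => ρ.changed)
          (load (fun ρ => { ρ with changed := false }) (jump .reset))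
          (jump .clearMat))
  | .reset =>
    pop .vals (fun ρ o => { ρ with elt := o }) <|
      branch (fun ρ => ρ.elt.isSome)
        (push .valsRead (fun ρ => ((ρ.elt.getD (d₀, .done)).1, .todo)) (jump .reset))
        (jump .rewMat)
  | .clearMat =>
    pop .mat (fun ρ o => { ρ with sym := o }) <|
      branch (fun ρ => ρ.sym.isSome) (jump .clearMat) (jump .clearVals)
  | .clearVals =>
    pop .vals (fun ρ o => { ρ with elt := o, ok := ρ.ok && o.elim true fun e => !bad e.1 }) <|
      branch (fun ρ => ρ.elt.isSome) (jump .clearVals)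
        -- The required halting configuration has initial registers and all stacks except the output
        -- empty.
        (push .out (fun ρ => ρ.ok) (load (fun _ => initReg d₀) halt))

/-- The contents of the stacks. -/
def stk (M M' : List MatSym) (L L' : List (D × Status)) (O : List Bool) :
    ∀ k, List (Alph D k)
  | .inp => M
  | .mat => M'
  | .vals => L
  | .valsRead => L'
  | .out => O

/-! ### Effect of pops and pushes -/

section StackOps

variable (M M' : List MatSym) (L L' : List (D × Status)) (O : List Bool)
  (q : TM2.Stmt (Alph D) Lbl (Reg D)) (ρ : Reg D)

@[simp] theorem stepAux_pop_inp (f : Reg D → Option (MatSym) → Reg D) :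
    TM2.stepAux (.pop .inp f q) ρ (stk M M' L L' O) =
      TM2.stepAux q (f ρ M.head?) (stk M.tail M' L L' O) := by
  refine congrArg (TM2.stepAux q _) ?_
  funext k; cases k <;> rfl

@[simp] theorem stepAux_pop_mat (f : Reg D → Option (MatSym) → Reg D) :
    TM2.stepAux (.pop .mat f q) ρ (stk M M' L L' O) =
      TM2.stepAux q (f ρ M'.head?) (stk M M'.tail L L' O) := by
  refine congrArg (TM2.stepAux q _) ?_
  funext k; cases k <;> rfl

@[simp] theorem stepAux_pop_vals (f : Reg D → Option (D × Status) → Reg D) :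
    TM2.stepAux (.pop .vals f q) ρ (stk M M' L L' O) =
      TM2.stepAux q (f ρ L.head?) (stk M M' L.tail L' O) := by
  refine congrArg (TM2.stepAux q _) ?_
  funext k; cases k <;> rfl

@[simp] theorem stepAux_pop_valsRead (f : Reg D → Option (D × Status) → Reg D) :
    TM2.stepAux (.pop .valsRead f q) ρ (stk M M' L L' O) =
      TM2.stepAux q (f ρ L'.head?) (stk M M' L L'.tail O) := by
  refine congrArg (TM2.stepAux q _) ?_
  funext k; cases k <;> rfl

@[simp] theorem stepAux_push_inp (f : Reg D → MatSym) :
    TM2.stepAux (.push .inp f q) ρ (stk M M' L L' O) = TM2.stepAux q ρ (stk (f ρ :: M) M' L L' O) := by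
  refine congrArg (TM2.stepAux q _) ?_
  funext k; cases k <;> rfl

@[simp] theorem stepAux_push_mat (f : Reg D → MatSym) :
    TM2.stepAux (.push .mat f q) ρ (stk M M' L L' O) = TM2.stepAux q ρ (stk M (f ρ :: M') L L' O) := by
  refine congrArg (TM2.stepAux q _) ?_
  funext k; cases k <;> rfl

@[simp] theorem stepAux_push_vals (f : Reg D → D × Status) :
    TM2.stepAux (.push .vals f q) ρ (stk M M' L L' O) = TM2.stepAux q ρ (stk M M' (f ρ :: L) L' O) := by
  refine congrArg (TM2.stepAux q _) ?_
  funext k; cases k <;> rfl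

@[simp] theorem stepAux_push_valsRead (f : Reg D → D × Status) :
    TM2.stepAux (.push .valsRead f q) ρ (stk M M' L L' O) = TM2.stepAux q ρ (stk M M' L (f ρ :: L') O) := by
  refine congrArg (TM2.stepAux q _) ?_
  funext k; cases k <;> rfl

@[simp] theorem stepAux_push_out (f : Reg D → Bool) :
    TM2.stepAux (.push .out f q) ρ (stk M M' L L' O) = TM2.stepAux q ρ (stk M M' L L' (f ρ :: O)) := by
  refine congrArg (TM2.stepAux q _) ?_
  funext k; cases k <;> rfl

end StackOps

/-- A configuration between two steps. -/
def cfg (l : Lbl) (w r : D) (c b : Bool) (M M' : List MatSym) (L L' : List (D × Status)) :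
    TM2.Cfg (Alph D) Lbl (Reg D) :=
  ⟨some l, ⟨none, none, w, r, c, b, true⟩, stk M M' L L' []⟩

/-! ### Timed runs of the individual loops -/

section Run

variable [LinearOrder D] (rev : MatSym → D × D → D × D) (d₀ : D) (bad : D → Bool)

/-- The machine gets from one configuration to another in at most `t` steps. -/
def Reach (t : ℕ) (C C' : TM2.Cfg (Alph D) Lbl (Reg D)) : Prop :=
  Nonempty (EvalsToInTime (TM2.step (prog rev d₀ bad)) C (some C') t)

variable {rev d₀ bad}

theorem Reach.refl (C : TM2.Cfg (Alph D) Lbl (Reg D)) : Reach rev d₀ bad 0 C C :=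
  ⟨EvalsToInTime.refl _ _⟩

theorem Reach.trans {t t' : ℕ} {C C' C'' : TM2.Cfg (Alph D) Lbl (Reg D)}
    (h : Reach rev d₀ bad t C C') (h' : Reach rev d₀ bad t' C' C'') :
    Reach rev d₀ bad (t + t') C C'' := by
  obtain ⟨h⟩ := h
  obtain ⟨h'⟩ := h'
  exact ⟨Nat.add_comm t t' ▸ EvalsToInTime.trans _ _ _ _ _ _ h h'⟩

theorem Reach.mono {t t' : ℕ} {C C' : TM2.Cfg (Alph D) Lbl (Reg D)}
    (h : Reach rev d₀ bad t C C') (ht : t ≤ t') : Reach rev d₀ bad t' C C' := by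
  obtain ⟨h⟩ := h
  exact ⟨⟨h.toEvalsTo, h.steps_le_m.trans ht⟩⟩

theorem Reach.single {C C' : TM2.Cfg (Alph D) Lbl (Reg D)}
    (h : TM2.step (prog rev d₀ bad) C = some C') : Reach rev d₀ bad 1 C C' :=
  ⟨⟨⟨1, h⟩, le_rfl⟩⟩

theorem Reach.head {t : ℕ} {C C' C'' : TM2.Cfg (Alph D) Lbl (Reg D)}
    (h : TM2.step (prog rev d₀ bad) C = some C') (h' : Reach rev d₀ bad t C' C'') :
    Reach rev d₀ bad (t + 1) C C'' :=
  ((Reach.single h).trans h').mono (Nat.add_comm _ _).le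

theorem reach_rewMat (w r : D) (c b : Bool) (M' : List MatSym) (L L' : List (D × Status)) :
    ∀ M : List MatSym, Reach rev d₀ bad (M'.length + 1) (cfg .rewMat w r c b M M' L L')
      (cfg .rewVals w r c b (M'.reverse ++ M) [] L L') := by
  induction M' with
  | nil => exact fun M => .single (by simp [-TM2.stepAux.eq_1, -TM2.stepAux.eq_3, cfg, prog, jump])
  | cons m M' ih =>
    intro M
    rw [List.reverse_cons, List.append_assoc]
    exact .head (by simp [-TM2.stepAux.eq_1, -TM2.stepAux.eq_3, cfg, prog, jump]) (ih (m :: M))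

theorem reach_clearMat (w r : D) (c b : Bool) (M M' : List MatSym) (L L' : List (D × Status)) :
    Reach rev d₀ bad (M'.length + 1) (cfg .clearMat w r c b M M' L L')
      (cfg .clearVals w r c b M [] L L') := by
  induction M' with
  | nil => exact .single (by simp [-TM2.stepAux.eq_1, -TM2.stepAux.eq_3, cfg, prog, jump])
  | cons m M' ih => exact .head (by simp [-TM2.stepAux.eq_1, -TM2.stepAux.eq_3, cfg, prog, jump]) ih

theorem reach_clearVals (w r : D) (c b : Bool) (L : List (D × Status)) :
    ∀ ok : Bool, Reach rev d₀ bad (L.length + 1)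
      ⟨some .clearVals, ⟨none, none, w, r, c, b, ok⟩, stk [] [] L [] []⟩
      ⟨none, initReg d₀, stk [] [] [] [] [ok && L.all fun e => !bad e.1]⟩ := by
  induction L with
  | nil => exact fun ok => .single (by simp [-TM2.stepAux.eq_1, -TM2.stepAux.eq_3, prog])
  | cons e L ih =>
    intro ok
    rw [List.all_cons, ← Bool.and_assoc]
    exact .head (by simp [-TM2.stepAux.eq_1, -TM2.stepAux.eq_3, prog, jump]) (ih _)

theorem reach_reset (w r : D) (c b : Bool) (M M' : List MatSym) (L : List (D × Status)) :
    ∀ L' : List (D × Status), Reach rev d₀ bad (L.length + 1) (cfg .reset w r c b M M' L L')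
      (cfg .rewMat w r c b M M' [] ((L.map fun e => (e.1, Status.todo)).reverse ++ L')) := by
  induction L with
  | nil => exact fun L' => .single (by simp [-TM2.stepAux.eq_1, -TM2.stepAux.eq_3, cfg, prog, jump])
  | cons e L ih =>
    intro L'
    rw [List.map_cons, List.reverse_cons, List.append_assoc]
    exact .head (by simp [-TM2.stepAux.eq_1, -TM2.stepAux.eq_3, cfg, prog, jump]) (ih ((e.1, .todo) :: L'))

variable {ι : Type}

theorem reach_rewVals_todo (w : D) (c b : Bool) (M M' : List MatSym) (L' : List (D × Status))
    (v : ι → D) (l : List ι) : ∀ (r : D) (L : List (D × Status)),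
    Reach rev d₀ bad l.length
      (cfg .rewVals w r c b M M' L (l.map (fun y => (v y, Status.todo)) ++ L'))
      (cfg .rewVals w (l.foldl (fun _ y => v y) r) c b M M'
        ((l.map fun y => (v y, Status.todo)).reverse ++ L) L') := by
  induction l with
  | nil => exact fun r L => .refl _
  | cons y l ih =>
    intro r L
    rw [List.map_cons, List.reverse_cons, List.append_assoc]
    exact .head (by simp [-TM2.stepAux.eq_1, -TM2.stepAux.eq_3, cfg, prog, jump, rewReg]) (ih (v y) ((v y, .todo) :: L))

theorem reach_rewVals_done (w r : D) (c b : Bool) (M M' : List MatSym) (L' : List (D × Status))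
    (v : ι → D) (l : List ι) : ∀ (L : List (D × Status)),
    Reach rev d₀ bad l.length
      (cfg .rewVals w r c b M M' L (l.map (fun y => (v y, Status.done)) ++ L'))
      (cfg .rewVals w r c b M M' ((l.map fun y => (v y, Status.done)).reverse ++ L) L') := by
  induction l with
  | nil => exact fun L => .refl _
  | cons y l ih =>
    intro L
    rw [List.map_cons, List.reverse_cons, List.append_assoc]
    exact .head (by simp [-TM2.stepAux.eq_1, -TM2.stepAux.eq_3, cfg, prog, jump, rewReg]) (ih ((v y, .done) :: L))

theorem reach_rewVals_cur (w r : D) (c b : Bool) (M M' : List MatSym) (L L' : List (D × Status))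
    (u : D) :
    Reach rev d₀ bad 1 (cfg .rewVals w r c b M M' L ((u, .cur) :: L'))
      (cfg .rewVals w r c b M M' ((max u w, .done) :: L) L') :=
  .single (by simp [-TM2.stepAux.eq_1, -TM2.stepAux.eq_3, cfg, prog, jump, rewReg])

theorem reach_rewVals_nil (w r : D) (c b : Bool) (M M' : List MatSym) (L : List (D × Status)) :
    Reach rev d₀ bad 1 (cfg .rewVals w r c b M M' L []) (cfg .scan r r c false M M' L []) :=
  .single (by simp [-TM2.stepAux.eq_1, -TM2.stepAux.eq_3, cfg, prog, jump, rewReg])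

section Scan

variable [DecidableEq ι] {s : ι → ι → MatSym}

theorem scan_apply_of_notMem {x y : ι} {l : List ι} (hy : y ∉ l) :
    ∀ b : Bool × D × (ι → D), (l.foldl (scanStep rev s x) b).2.2 y = b.2.2 y := by
  induction l with
  | nil => exact fun _ => rfl
  | cons z l ih =>
    intro b
    rw [List.mem_cons, not_or] at hy
    rw [List.foldl_cons, ih hy.2]
    simp [scanStep, Function.update_of_ne hy.1]

variable (hs : ∀ x y, s x y ≠ .endRow)
include hs

/-- The condition on `st` excludes the only case in which a status changes. Without repetitions each
column is touched once: unread entries still carry their old bounds, and read entries already carry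
their final ones. -/
theorem reach_scan_segment (x : ι) (r : D) (b : Bool) (st : Status) (hst : st = .todo → b = true)
    (M : List MatSym) (L : List (D × Status)) (l : List ι) (hl : l.Nodup) :
    ∀ (a : Bool × D × (ι → D)) (M' : List MatSym) (L' : List (D × Status)),
    Reach rev d₀ bad l.length
      (cfg .scan a.2.1 r a.1 b (l.map (s x) ++ M) M' (l.map (fun y => (a.2.2 y, st)) ++ L) L')
      (cfg .scan (l.foldl (scanStep rev s x) a).2.1 r (l.foldl (scanStep rev s x) a).1 b
        M ((l.map (s x)).reverse ++ M') L
        ((l.map fun y => ((l.foldl (scanStep rev s x) a).2.2 y, st)).reverse ++ L')) := by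
  induction l with
  | nil => exact fun a M' L' => .refl _
  | cons y l ih =>
    intro a M' L'
    rw [List.nodup_cons] at hl
    have hmap : l.map (fun z => (a.2.2 z, st)) =
        l.map (fun z => ((scanStep rev s x a y).2.2 z, st)) := by
      refine List.map_congr_left fun z hz => ?_
      have hne : z ≠ y := fun h => hl.1 (h ▸ hz)
      simp [scanStep, Function.update_of_ne hne]
    have hst' : st ≠ .todo ∨ b = true := (em (st = .todo)).symm.imp_right hst
    have hy : ((l.foldl (scanStep rev s x) (scanStep rev s x a y)).2.2 y) =
        (rev (s x y) (a.2.1, a.2.2 y)).2 := by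
      rw [scan_apply_of_notMem hl.1]
      simp [scanStep]
    have key := ih hl.2 (scanStep rev s x a y) (s x y :: M')
      (((rev (s x y) (a.2.1, a.2.2 y)).2, st) :: L')
    simp only [List.map_cons, List.reverse_cons, List.append_assoc, List.foldl_cons, hy]
    refine .head ?_ key
    rw [← hmap]
    rcases hst' with h | h
    · simp [-TM2.stepAux.eq_1, -TM2.stepAux.eq_3, cfg, prog, jump, scanReg, hs, h, scanStep]
      congr
    · simp [-TM2.stepAux.eq_1, -TM2.stepAux.eq_3, cfg, prog, jump, scanReg, hs, h, scanStep]
      congr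

/-- Used on the diagonal, where the row's own vertex gets marked. -/
theorem reach_scan_cur (x : ι) (r : D) (a : Bool × D × (ι → D)) (y : ι) (M M' : List MatSym)
    (L L' : List (D × Status)) :
    Reach rev d₀ bad 1
      (cfg .scan a.2.1 r a.1 false (s x y :: M) M' ((a.2.2 y, .todo) :: L) L')
      (cfg .scan (scanStep rev s x a y).2.1 r (scanStep rev s x a y).1 true M (s x y :: M') L
        (((scanStep rev s x a y).2.2 y, .cur) :: L')) :=
  .single (by
    simp [-TM2.stepAux.eq_1, -TM2.stepAux.eq_3, cfg, prog, jump, scanReg, hs, scanStep]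
    congr)

omit hs in
theorem reach_scan_endRow (w r : D) (c b : Bool) (M M' : List MatSym) (L L' : List (D × Status)) :
    Reach rev d₀ bad 1 (cfg .scan w r c b (.endRow :: M) M' L L')
      (cfg .rewVals w r c b M (.endRow :: M') L L') :=
  .single (by simp [-TM2.stepAux.eq_1, -TM2.stepAux.eq_3, cfg, prog, jump])

end Scan

end Run

end PropagationMachine
namespace PropagationMachine

open Turing StateTransition Propagation

/-! ### Rows, sweeps and the complete run -/

section Sweeps

variable {D : Type} [LinearOrder D] {rev : MatSym → D × D → D × D} {d₀ : D} {bad : D → Bool}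
  {ι : Type}

/-- The row of `x` with its end marker. -/
def rowSyms (s : ι → ι → MatSym) (l : List ι) (x : ι) : List MatSym :=
  l.map (s x) ++ [.endRow]

/-- The matrix, row by row. -/
def matSyms (s : ι → ι → MatSym) (l : List ι) : List MatSym :=
  l.flatMap (rowSyms s l)

theorem length_matSyms (s : ι → ι → MatSym) (l : List ι) :
    (matSyms s l).length = l.length * (l.length + 1) := by
  simp [matSyms, rowSyms, List.length_flatMap]

theorem reach_init_row (w r : D) (c b : Bool) (M : List MatSym) (L L' : List (D × Status))
    (l : List MatSym) (hl : .endRow ∉ l) : ∀ M' : List MatSym,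
    Reach rev d₀ bad (l.length + 1)
      (cfg .init w r c b (l ++ .endRow :: M) M' L L')
      (cfg .init w r c b M (.endRow :: (l.reverse ++ M')) L ((d₀, .todo) :: L')) := by
  induction l with
  | nil =>
    exact fun M' => .single
      (by simp [-TM2.stepAux.eq_1, -TM2.stepAux.eq_3, cfg, prog, jump])
  | cons m l ih =>
    intro M'
    rw [List.mem_cons, not_or] at hl
    rw [List.reverse_cons, List.append_assoc]
    exact .head (by simp [-TM2.stepAux.eq_1, -TM2.stepAux.eq_3, cfg, prog, jump, Ne.symm hl.1])
      (ih hl.2 (m :: M'))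

variable {s : ι → ι → MatSym} (hs : ∀ x y, s x y ≠ .endRow)
include hs

theorem reach_init (w r : D) (c b : Bool) (l l' : List ι) :
    ∀ (M' : List MatSym) (L' : List (D × Status)),
    Reach rev d₀ bad ((l'.flatMap (rowSyms s l)).length + 1)
      (cfg .init w r c b (l'.flatMap (rowSyms s l)) M' [] L')
      (cfg .rewMat w r c b [] ((l'.flatMap (rowSyms s l)).reverse ++ M') []
        ((l'.map fun _ => (d₀, Status.todo)).reverse ++ L')) := by
  induction l' with
  | nil =>
    exact fun M' L' => .single
      (by simp [-TM2.stepAux.eq_1, -TM2.stepAux.eq_3, cfg, prog, jump])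
  | cons x l' ih =>
    intro M' L'
    have h1 := reach_init_row (rev := rev) (d₀ := d₀) (bad := bad) w r c b
      (l'.flatMap (rowSyms s l)) [] L' (l.map (s x)) (by simp [hs]) M'
    have h2 := h1.trans (ih _ _)
    simp only [List.flatMap_cons, rowSyms, List.append_assoc, List.cons_append, List.nil_append,
      List.reverse_append, List.reverse_cons, List.map_cons, List.length_append, List.length_cons,
      List.length_map] at h2 ⊢
    exact h2.mono (by omega)

variable [DecidableEq ι]

/-- The scan passes `pre`, the diagonal entry, `post` and the end marker; the rewinding passes
`post`, `x`, `pre` and then detects the empty stack. Each direction costs `l.length + 1` steps. -/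
theorem reach_row {l pre post : List ι} {x : ι} (hl : l = pre ++ x :: post) (hnd : l.Nodup)
    (a : Bool × (ι → D)) (r : D) (M M' : List MatSym) :
    ∃ r' : D, (∀ y ∈ post.head?, r' = (rowStep rev s l a x).2 y) ∧
      Reach rev d₀ bad (2 * l.length + 2)
        (cfg .scan (a.2 x) r a.1 false (rowSyms s l x ++ M) M'
          (pre.map (fun y => (a.2 y, Status.done)) ++
            (x :: post).map (fun y => (a.2 y, Status.todo))) [])
        (cfg .scan r' r' (rowStep rev s l a x).1 false M ((rowSyms s l x).reverse ++ M')
          ((pre ++ [x]).map (fun y => ((rowStep rev s l a x).2 y, Status.done)) ++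
            post.map (fun y => ((rowStep rev s l a x).2 y, Status.todo))) []) := by
  have hnd' := hnd
  rw [hl, List.nodup_append, List.nodup_cons] at hnd'
  obtain ⟨hpre, ⟨hxpost, hpost⟩, hdisj⟩ := hnd'
  have hxpre : x ∉ pre := fun h => hdisj x h x List.mem_cons_self rfl
  have hpp : ∀ y ∈ post, y ∉ pre := fun y hy h => hdisj y h y (List.mem_cons_of_mem _ hy) rfl
  obtain ⟨F0, hF0⟩ : ∃ F, pre.foldl (scanStep rev s x) (a.1, a.2 x, a.2) = F := ⟨_, rfl⟩
  obtain ⟨F1, hF1⟩ : ∃ F, scanStep rev s x F0 x = F := ⟨_, rfl⟩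
  obtain ⟨F2, hF2⟩ : ∃ F, post.foldl (scanStep rev s x) F1 = F := ⟨_, rfl⟩
  have hF : l.foldl (scanStep rev s x) (a.1, a.2 x, a.2) = F2 := by
    rw [hl, List.foldl_append, hF0, List.foldl_cons, hF1, hF2]
  have h0 : ∀ y, y ∉ pre → F0.2.2 y = a.2 y := fun y hy => by
    rw [← hF0, scan_apply_of_notMem hy]
  have h1 : ∀ y, y ≠ x → F1.2.2 y = F0.2.2 y := fun y hy => by
    rw [← hF1]; simp [scanStep, Function.update_of_ne hy]
  have h2 : ∀ y, y ∉ post → F2.2.2 y = F1.2.2 y := fun y hy => by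
    rw [← hF2, scan_apply_of_notMem hy]
  have hrow : rowStep rev s l a x =
      (F2.1, Function.update F2.2.2 x (max (F2.2.2 x) F2.2.1)) := by
    rw [rowStep, hF]
  rw [hrow]
  dsimp only
  have e1 : post.map (fun y => (a.2 y, Status.todo)) =
      post.map (fun y => (F1.2.2 y, Status.todo)) := List.map_congr_left fun y hy => by
    rw [h1 y (fun h => hxpost (h ▸ hy)), h0 y (hpp y hy)]
  have e2 : pre.map (fun y => (F0.2.2 y, Status.done)) = pre.map (fun y =>
      (Function.update F2.2.2 x (max (F2.2.2 x) F2.2.1) y, Status.done)) :=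
    List.map_congr_left fun y hy => by
      have hyx : y ≠ x := fun h => hxpre (h ▸ hy)
      rw [Function.update_of_ne hyx, h2 y (fun h => hpp y h hy), h1 y hyx]
  have e3 : post.map (fun y => (F2.2.2 y, Status.todo)) = post.map (fun y =>
      (Function.update F2.2.2 x (max (F2.2.2 x) F2.2.1) y, Status.todo)) :=
    List.map_congr_left fun y hy => by
      rw [Function.update_of_ne (ne_of_mem_of_not_mem hy hxpost)]
  -- This is the bound of the head of `post`, or the old register content `r` if no row remains.
  refine ⟨post.reverse.foldl (fun _ y => F2.2.2 y) r, ?_, ?_⟩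
  · rintro y hy
    rcases post with _ | ⟨z, post⟩
    · simp at hy
    · simp only [List.head?_cons, Option.mem_some_iff] at hy
      subst hy
      rw [Function.update_of_ne (ne_of_mem_of_not_mem List.mem_cons_self hxpost), List.reverse_cons,
        List.foldl_append]
      rfl
  · have s1 := reach_scan_segment (rev := rev) (d₀ := d₀) (bad := bad) hs x r false .done
      (by simp) (s x x :: (post.map (s x) ++ .endRow :: M))
      ((a.2 x, .todo) :: post.map (fun y => (a.2 y, Status.todo))) pre hpre
      (a.1, a.2 x, a.2) M' []
    rw [hF0] at s1
    have s2 := reach_scan_cur (rev := rev) (d₀ := d₀) (bad := bad) hs x r F0 x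
      (post.map (s x) ++ .endRow :: M) ((pre.map (s x)).reverse ++ M')
      (post.map (fun y => (a.2 y, Status.todo)))
      ((pre.map fun y => (F0.2.2 y, Status.done)).reverse ++ [])
    rw [hF1, h0 x hxpre] at s2
    have s3 := reach_scan_segment (rev := rev) (d₀ := d₀) (bad := bad) hs x r true .todo
      (by simp) (.endRow :: M) [] post hpost F1 (s x x :: ((pre.map (s x)).reverse ++ M'))
      ((F1.2.2 x, .cur) :: ((pre.map fun y => (F0.2.2 y, Status.done)).reverse ++ []))
    rw [hF2, List.append_nil (post.map _), ← e1] at s3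
    have s4 := reach_scan_endRow (rev := rev) (d₀ := d₀) (bad := bad) F2.2.1 r F2.1 true M
      ((post.map (s x)).reverse ++ (s x x :: ((pre.map (s x)).reverse ++ M'))) []
      ((post.map fun y => (F2.2.2 y, Status.todo)).reverse ++ ((F1.2.2 x, .cur) ::
        ((pre.map fun y => (F0.2.2 y, Status.done)).reverse ++ [])))
    have s5 := reach_rewVals_todo (rev := rev) (d₀ := d₀) (bad := bad) F2.2.1 F2.1 true M
      (.endRow :: ((post.map (s x)).reverse ++ (s x x :: ((pre.map (s x)).reverse ++ M'))))
      ((F1.2.2 x, .cur) :: ((pre.map fun y => (F0.2.2 y, Status.done)).reverse ++ []))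
      F2.2.2 post.reverse r []
    rw [List.map_reverse, List.reverse_reverse, e3] at s5
    rw [e3] at s4
    have s6 := reach_rewVals_cur (rev := rev) (d₀ := d₀) (bad := bad) F2.2.1
      (post.reverse.foldl (fun _ y => F2.2.2 y) r) F2.1 true M
      (.endRow :: ((post.map (s x)).reverse ++ (s x x :: ((pre.map (s x)).reverse ++ M'))))
      (post.map fun y => (Function.update F2.2.2 x (max (F2.2.2 x) F2.2.1) y, Status.todo))
      ((pre.map fun y => (F0.2.2 y, Status.done)).reverse ++ []) (F1.2.2 x)
    have s7 := reach_rewVals_done (rev := rev) (d₀ := d₀) (bad := bad) F2.2.1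
      (post.reverse.foldl (fun _ y => F2.2.2 y) r) F2.1 true M
      (.endRow :: ((post.map (s x)).reverse ++ (s x x :: ((pre.map (s x)).reverse ++ M'))))
      [] F0.2.2 pre.reverse ((max (F1.2.2 x) F2.2.1, .done) ::
        (post.map fun y => (Function.update F2.2.2 x (max (F2.2.2 x) F2.2.1) y, Status.todo)))
    rw [List.map_reverse, List.reverse_reverse, e2] at s7
    rw [e2] at s1 s2 s6 s5 s4
    rw [e2, e3] at s3
    have s8 := reach_rewVals_nil (rev := rev) (d₀ := d₀) (bad := bad) F2.2.1
      (post.reverse.foldl (fun _ y => F2.2.2 y) r) F2.1 true M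
      (.endRow :: ((post.map (s x)).reverse ++ (s x x :: ((pre.map (s x)).reverse ++ M'))))
      ((pre.map fun y => (Function.update F2.2.2 x (max (F2.2.2 x) F2.2.1) y, Status.done)) ++
        ((max (F1.2.2 x) F2.2.1, .done) ::
        (post.map fun y => (Function.update F2.2.2 x (max (F2.2.2 x) F2.2.1) y, Status.todo))))
    simp only [List.append_nil] at s1 s2 s3 s4 s5 s6 s7
    have key := (((((((s1.trans s2).trans s3).trans s4).trans s5).trans s6).trans s7).trans s8)
    have hlen : l.length = pre.length + (post.length + 1) := by simp [hl]
    have key' := key.mono (t' := 2 * l.length + 2) (by simp only [List.length_reverse]; omega)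
    have hR : rowSyms s l x ++ M =
        pre.map (s x) ++ s x x :: (post.map (s x) ++ .endRow :: M) := by
      simp [rowSyms, hl]
    have hR' : (rowSyms s l x).reverse ++ M' =
        .endRow :: ((post.map (s x)).reverse ++ (s x x :: ((pre.map (s x)).reverse ++ M'))) := by
      simp [rowSyms, hl]
    rw [hR, hR', List.map_append, List.map_singleton, Function.update_self, h2 x hxpost,
      List.append_assoc, List.singleton_append, List.map_cons]
    rw [h2 x hxpost] at key'
    exact key'

theorem reach_rows {l : List ι} (hnd : l.Nodup) (post : List ι) :
    ∀ (pre : List ι) (a : Bool × (ι → D)) (r : D) (M' : List MatSym), l = pre ++ post →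
    (∀ y ∈ post.head?, r = a.2 y) →
    ∃ r' : D, Reach rev d₀ bad (post.length * (2 * l.length + 2))
      (cfg .scan r r a.1 false (post.flatMap (rowSyms s l)) M'
        (pre.map (fun y => (a.2 y, Status.done)) ++ post.map (fun y => (a.2 y, Status.todo))) [])
      (cfg .scan r' r' (post.foldl (rowStep rev s l) a).1 false []
        ((post.flatMap (rowSyms s l)).reverse ++ M')
        (l.map (fun y => ((post.foldl (rowStep rev s l) a).2 y, Status.done))) []) := by
  induction post with
  | nil =>
    intro pre a r M' hl _
    rw [List.append_nil] at hl
    subst hl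
    refine ⟨r, ?_⟩
    simpa using Reach.refl _
  | cons x post ih =>
    intro pre a r M' hl hr
    obtain rfl := hr x rfl
    obtain ⟨r₁, h1, h2⟩ := reach_row (rev := rev) (d₀ := d₀) (bad := bad) hs hl hnd a (a.2 x)
      (post.flatMap (rowSyms s l)) M'
    obtain ⟨r₂, h3⟩ := ih (pre ++ [x]) (rowStep rev s l a x) r₁ ((rowSyms s l x).reverse ++ M')
      (by simp [hl]) h1
    refine ⟨r₂, ?_⟩
    rw [List.flatMap_cons, List.reverse_append, List.append_assoc, List.foldl_cons]
    exact (h2.trans h3).mono (by rw [List.length_cons]; ring_nf; rfl)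

/-- The rows together cost twice the matrix length; the rest is rewinding the matrix, rewinding the
bounds, testing the flag and possibly resetting the statuses. -/
theorem reach_sweep {l : List ι} (hnd : l.Nodup) (v : ι → D) (w r : D) (b : Bool) :
    ∃ r' : D, Reach rev d₀ bad (5 * (matSyms s l).length + 4)
      (cfg .rewMat w r false b [] (matSyms s l).reverse []
        (l.map fun y => (v y, Status.todo)).reverse)
      (if (sweep rev s l v).1 then
        cfg .rewMat r' r' false false [] (matSyms s l).reverse []
          (l.map fun y => ((sweep rev s l v).2 y, Status.todo)).reverse
      else
        cfg .clearMat r' r' false false [] (matSyms s l).reverse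
          (l.map fun y => ((sweep rev s l v).2 y, Status.done)) []) := by
  have s1 := reach_rewMat (rev := rev) (d₀ := d₀) (bad := bad) w r false b
    (matSyms s l).reverse [] (l.map fun y => (v y, Status.todo)).reverse []
  have s2 := reach_rewVals_todo (rev := rev) (d₀ := d₀) (bad := bad) w false b
    (matSyms s l) [] [] v l.reverse r []
  have s3 := reach_rewVals_nil (rev := rev) (d₀ := d₀) (bad := bad) w
    (l.reverse.foldl (fun _ y => v y) r) false b (matSyms s l) []
    (l.map fun y => (v y, Status.todo))
  have hr : ∀ y ∈ l.head?, l.reverse.foldl (fun _ y => v y) r = v y := by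
    rcases l with _ | ⟨z, l⟩
    · simp
    · simp [List.foldl_append]
  obtain ⟨r', s4⟩ := reach_rows (rev := rev) (d₀ := d₀) (bad := bad) hs hnd l [] (false, v)
    (l.reverse.foldl (fun _ y => v y) r) [] rfl hr
  change Reach _ _ _ _ (cfg _ _ _ _ _ (matSyms s l) _ _ _)
    (cfg _ _ _ (sweep rev s l v).1 _ _ ((matSyms s l).reverse ++ []) _ _) at s4
  rw [List.append_nil, List.map_nil, List.nil_append] at s4
  rw [List.map_reverse, List.append_nil, List.append_nil, List.reverse_reverse] at s2
  rw [List.reverse_reverse, List.append_nil] at s1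
  have key := ((s1.trans s2).trans s3).trans s4
  have hlen := length_matSyms s l
  have hlen' : l.length ≤ (matSyms s l).length := by rw [hlen]; nlinarith
  have hlen'' : l.length * (2 * l.length + 2) = 2 * (matSyms s l).length := by rw [hlen]; ring
  rw [List.length_reverse, List.length_reverse, hlen''] at key
  refine ⟨r', ?_⟩
  cases hc : (sweep rev s l v).1
  · rw [hc] at key
    refine (key.trans (.single (C' := cfg .clearMat r' r' false false [] (matSyms s l).reverse
          (l.map fun y => ((sweep rev s l v).2 y, Status.done)) []) ?_)).mono (by omega)
    simp [-TM2.stepAux.eq_1, -TM2.stepAux.eq_3, cfg, prog, jump]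
    rfl
  · rw [hc] at key
    have s5 : Reach rev d₀ bad 1 _ (cfg .reset r' r' false false [] (matSyms s l).reverse
        (l.map fun y => ((sweep rev s l v).2 y, Status.done)) []) :=
      .single (C := cfg .scan r' r' true false [] (matSyms s l).reverse
        (l.map fun y => ((sweep rev s l v).2 y, Status.done)) [])
        (by simp [-TM2.stepAux.eq_1, -TM2.stepAux.eq_3, cfg, prog, jump])
    have s6 := reach_reset (rev := rev) (d₀ := d₀) (bad := bad) r' r' false false []
      (matSyms s l).reverse (l.map fun y => ((sweep rev s l v).2 y, Status.done)) []
    rw [List.append_nil, List.map_map, List.length_map] at s6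
    exact ((key.trans s5).trans s6).mono (by omega)

/-- Induction on a bound for the remaining potential `B - μ v`. A sweep with changes uses up at
least one unit, so once none is left the next sweep must end with a low flag. -/
theorem reach_sweeps (hmono : ∀ c, Monotone (rev c)) (hext : ∀ c p, p ≤ rev c p)
    {l : List ι} (hnd : l.Nodup) (hl : ∀ x, x ∈ l) {μ : (ι → D) → ℕ} (hμ : StrictMono μ) {B : ℕ}
    (hB : ∀ v, μ v ≤ B) (n : ℕ) : ∀ (v : ι → D) (w r : D) (b : Bool), B - μ v ≤ n →
    ∃ (v' : ι → D) (r' : D), (∀ x y, rev (s x y) (v' x, v' y) = (v' x, v' y)) ∧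
      (∀ g : ι → D, (∀ x y, rev (s x y) (g x, g y) = (g x, g y)) → v ≤ g → v' ≤ g) ∧
      Reach rev d₀ bad ((n + 1) * (5 * (matSyms s l).length + 4))
        (cfg .rewMat w r false b [] (matSyms s l).reverse []
          (l.map fun y => (v y, Status.todo)).reverse)
        (cfg .clearMat r' r' false false [] (matSyms s l).reverse
          (l.map fun y => (v' y, Status.done)) []) := by
  induction n with
  | zero =>
    intro v w r b hv
    obtain ⟨r', h⟩ := reach_sweep (rev := rev) (d₀ := d₀) (bad := bad) hs hnd v w r b
    have hc : (sweep rev s l v).1 = false := by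
      by_contra hc
      have := hμ (sweep_progress (s := s) hext l v (by simpa using hc))
      have := hB (sweep rev s l v).2
      omega
    obtain ⟨h1, h2⟩ := sweep_flag l v hc
    rw [hc, h1] at h
    exact ⟨v, r', fun x y => h2 x (hl x) y (hl y), fun g _ h => h, by simpa using h⟩
  | succ n ih =>
    intro v w r b hv
    obtain ⟨r', h⟩ := reach_sweep (rev := rev) (d₀ := d₀) (bad := bad) hs hnd v w r b
    cases hc : (sweep rev s l v).1
    · obtain ⟨h1, h2⟩ := sweep_flag l v hc
      rw [hc, h1] at h
      refine ⟨v, r', fun x y => h2 x (hl x) y (hl y), fun g _ h => h, ?_⟩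
      exact Reach.mono (by simpa using h) (Nat.le_mul_of_pos_left _ (Nat.succ_pos _))
    · have hlt := hμ (sweep_progress (s := s) hext l v hc)
      have hle := hB (sweep rev s l v).2
      obtain ⟨v', r'', h1, h2, h3⟩ := ih (sweep rev s l v).2 r' r' false (by omega)
      rw [hc, if_pos rfl] at h
      exact ⟨v', r'', h1, fun g hg hvg => h2 g hg (sweep_le hmono hg l v hvg),
        (h.trans h3).mono (by rw [Nat.add_mul (n + 1), Nat.one_mul, Nat.add_comm])⟩

/-- At most `B + 1` sweeps are made; the remaining unit in `B + 2` pays for loading the input and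
clearing the stacks. -/
theorem reach_answer (hmono : ∀ c, Monotone (rev c)) (hext : ∀ c p, p ≤ rev c p)
    {l : List ι} (hnd : l.Nodup) (hl : ∀ x, x ∈ l) {μ : (ι → D) → ℕ} (hμ : StrictMono μ) {B : ℕ}
    (hB : ∀ v, μ v ≤ B) (hd₀ : ∀ d, d₀ ≤ d) :
    ∃ v : ι → D, (∀ x y, rev (s x y) (v x, v y) = (v x, v y)) ∧
      (∀ g : ι → D, (∀ x y, rev (s x y) (g x, g y) = (g x, g y)) → v ≤ g) ∧
      Reach rev d₀ bad ((B + 2) * (5 * (matSyms s l).length + 4))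
        (cfg .init d₀ d₀ false false (matSyms s l) [] [] [])
        ⟨none, initReg d₀, stk [] [] [] [] [l.all fun y => !bad (v y)]⟩ := by
  have s1 := reach_init (rev := rev) (d₀ := d₀) (bad := bad) hs d₀ d₀ false false l l [] []
  obtain ⟨v, r', h1, h2, s2⟩ := reach_sweeps (rev := rev) (d₀ := d₀) (bad := bad) hs hmono hext
    hnd hl hμ hB B (fun _ => d₀) d₀ d₀ false (Nat.sub_le _ _)
  have s3 := reach_clearMat (rev := rev) (d₀ := d₀) (bad := bad) r' r' false false []
    (matSyms s l).reverse (l.map fun y => (v y, Status.done)) []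
  have s4 := reach_clearVals (rev := rev) (d₀ := d₀) (bad := bad) r' r' false false
    (l.map fun y => (v y, Status.done)) true
  rw [List.append_nil, List.append_nil] at s1
  refine ⟨v, h1, fun g hg => h2 g hg fun y => hd₀ _, ?_⟩
  have key := ((s1.trans s2).trans s3).trans s4
  have hlen' : l.length ≤ (matSyms s l).length := by rw [length_matSyms]; nlinarith
  rw [List.length_reverse, List.length_map, List.all_map, Bool.true_and] at key
  refine key.mono ?_
  change (matSyms s l).length + 1 + _ + _ + _ ≤ _
  have : (B + 2) * (5 * (matSyms s l).length + 4) =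
    (B + 1) * (5 * (matSyms s l).length + 4) + (5 * (matSyms s l).length + 4) := by ring
  omega

end Sweeps

end PropagationMachine

/-! ### Navigational homomorphisms to directed paths -/

namespace RGP

open RegularExpression

variable {α V : Type} {a : α}

theorem mem_matches'_charPlus {u : List α} :
    u ∈ (char a * star (char a)).matches' ↔ u ≠ [] ∧ ∀ c ∈ u, c = a := by
  rw [matches'_mul, matches'_star, matches'_char, Language.mem_mul]
  constructor
  · rintro ⟨b, rfl, w, hw, rfl⟩
    rw [Language.mem_kstar] at hw
    obtain ⟨S, rfl, hS⟩ := hw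
    refine ⟨by simp, ?_⟩
    intro c hc
    rcases List.mem_append.1 hc with hc | hc
    · simpa using hc
    · obtain ⟨t, ht, hct⟩ := List.mem_flatten.1 hc
      obtain rfl : t = [a] := hS t ht
      exact List.mem_singleton.1 hct
  · rintro ⟨h1, h2⟩
    rcases u with _ | ⟨c, u⟩
    · exact absurd rfl h1
    · obtain rfl : c = a := h2 c List.mem_cons_self
      refine ⟨[c], rfl, u, ?_, rfl⟩
      rw [Language.mem_kstar]
      refine ⟨u.map fun x => [x], by rw [← List.flatMap_def, List.flatMap_singleton'], ?_⟩
      intro t ht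
      obtain ⟨x, hx, rfl⟩ := List.mem_map.1 ht
      rw [h2 x (List.mem_cons_of_mem _ hx)]
      rfl

theorem singleton_mem_of_label {Q : RGP α V} (hlabels : Q.LabelsAAPlus a) {x y : V}
    {E : RegularExpression α} (h : Q.label x y = some E) : [a] ∈ E.matches' := by
  rcases hlabels x y E h with rfl | rfl
  · rfl
  · exact mem_matches'_charPlus.2 (by simp)

theorem eq_of_mem_of_label {Q : RGP α V} (hlabels : Q.LabelsAAPlus a) {x y : V}
    {E : RegularExpression α} (h : Q.label x y = some E) {u : List α} (hu : u ∈ E.matches') :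
    u ≠ [] ∧ ∀ c ∈ u, c = a := by
  rcases hlabels x y E h with rfl | rfl
  · obtain rfl : u = [a] := hu
    simp
  · exact mem_matches'_charPlus.1 hu

/-! ### Words read along a directed path -/

section Path

variable {Q : RGP α V} {n : ℕ} {q : Fin (n + 1) ≃ V}
  (hq : ∀ i j : Fin (n + 1), Q.graph.Adj (q i) (q j) ↔ (i : ℕ) + 1 = (j : ℕ))
  (hlabels : Q.LabelsAAPlus a)
include hq

theorem index_of_label {x y : V} {E : RegularExpression α} (h : Q.label x y = some E) :
    (q.symm x : ℕ) + 1 = q.symm y := by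
  have := (hq (q.symm x) (q.symm y)).1 (by simp [graph, h])
  exact this

include hlabels

/-- Taking the word `a` on every arc gives a word as long as the walk, and on a path that length is
the difference of positions. -/
theorem Walk.exists_mem_label {x y : V} (w : Q.Walk x y) :
    ∃ u ∈ w.label.matches', (q.symm x : ℕ) + u.length = q.symm y := by
  induction w with
  | nil x => exact ⟨[], rfl, rfl⟩
  | cons E h w ih =>
    obtain ⟨u, hu, hlen⟩ := ih
    refine ⟨[a] ++ u, Language.append_mem_mul (singleton_mem_of_label hlabels h) hu, ?_⟩
    have := index_of_label hq h
    simp only [List.length_append, List.length_singleton]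
    omega

theorem Walk.of_mem_label {x y : V} (w : Q.Walk x y) :
    ∀ u ∈ w.label.matches', (∀ c ∈ u, c = a) ∧ (q.symm y : ℕ) ≤ q.symm x + u.length := by
  induction w with
  | nil x =>
    intro u hu
    obtain rfl : u = [] := hu
    simp
  | cons E h w ih =>
    intro u hu
    obtain ⟨u₁, h₁, u₂, h₂, rfl⟩ := Language.mem_mul.1 hu
    obtain ⟨h3, h4⟩ := ih u₂ h₂
    obtain ⟨h5, h6⟩ := eq_of_mem_of_label hlabels h h₁
    have := index_of_label hq h
    have := List.length_pos_iff.2 h5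
    refine ⟨fun c hc => (List.mem_append.1 hc).elim (h6 c) (h3 c), ?_⟩
    rw [List.length_append]
    omega

omit hlabels in
theorem nonempty_walk (i j : Fin (n + 1)) (h : i ≤ j) : Nonempty (Q.Walk (q i) (q j)) := by
  obtain ⟨d, hd⟩ := Nat.exists_eq_add_of_le (Fin.le_def.1 h)
  induction d generalizing i with
  | zero =>
    obtain rfl : i = j := Fin.ext hd.symm
    exact ⟨.nil _⟩
  | succ d ih =>
    have hi : (i : ℕ) + 1 < n + 1 := by omega
    obtain ⟨w⟩ := ih ⟨i + 1, hi⟩ (Fin.le_def.2 (by simp; omega)) (by simp; omega)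
    have hadj := (hq i ⟨i + 1, hi⟩).2 rfl
    obtain ⟨E, hE⟩ := Option.isSome_iff_exists.1 hadj
    exact ⟨.cons E hE w⟩

theorem exists_walk_char_iff (x y : V) :
    (∃ w : Q.Walk x y, w.label.matches' ≤ (char a).matches') ↔ Q.label x y = some (char a) := by
  constructor
  · rintro ⟨w, hw⟩
    obtain ⟨u, hu, hlen⟩ := w.exists_mem_label hq hlabels
    obtain rfl : u = [a] := hw hu
    rcases w with _ | ⟨E, h, w⟩
    · simp at hlen
    · rename_i z
      have hz := index_of_label hq h
      have hzy : z = y := q.symm.injective (Fin.ext (by simp at hlen; omega))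
      subst hzy
      obtain ⟨u', hu', hlen'⟩ := w.exists_mem_label hq hlabels
      rcases hlabels _ _ E h with rfl | rfl
      · exact h
      · have hmem : [a, a] ++ u' ∈ (char a).matches' :=
          hw (Language.append_mem_mul (mem_matches'_charPlus.2 (by simp)) hu')
        have h2 : [a, a] ++ u' = [a] := hmem
        simp at h2
  · intro h
    refine ⟨.cons _ h (.nil _), ?_⟩
    change (char a).matches' * 1 ≤ _
    rw [mul_one]

/-- Any walk of positive length works, since each of its arcs contributes only nonempty powers of
`a`. -/
theorem exists_walk_charPlus_iff (x y : V) :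
    (∃ w : Q.Walk x y, w.label.matches' ≤ (char a * star (char a)).matches') ↔
      q.symm x < q.symm y := by
  constructor
  · rintro ⟨w, hw⟩
    obtain ⟨u, hu, hlen⟩ := w.exists_mem_label hq hlabels
    have := List.length_pos_iff.2 (mem_matches'_charPlus.1 (hw hu)).1
    exact Fin.lt_def.2 (by omega)
  · intro h
    obtain ⟨w⟩ := nonempty_walk hq (q.symm x) (q.symm y) h.le
    rw [q.apply_symm_apply, q.apply_symm_apply] at w
    refine ⟨w, fun u hu => mem_matches'_charPlus.2 ?_⟩
    obtain ⟨h1, h2⟩ := w.of_mem_label hq hlabels u hu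
    refine ⟨?_, h1⟩
    rintro rfl
    rw [Fin.lt_def] at h
    simp at h2
    omega

end Path

end RGP

/-! ### Positions, bound revision and the deciding machine -/

namespace AAPlusInstance

open RegularExpression RGP Propagation PropagationMachine Turing

variable {α V : Type} {a : α}

theorem char_ne_charPlus : char a ≠ char a * star (char a) := by
  intro h
  cases h

theorem entry_eq_arcA_iff (P : AAPlusInstance a) (x y : Fin P.n) :
    P.entry x y = .arcA ↔ P.rgp.label x y = some (char a) := by
  unfold entry
  split_ifs with h1 h2 <;> simp_all

theorem entry_eq_arcAPlus_iff (P : AAPlusInstance a) (x y : Fin P.n) :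
    P.entry x y = .arcAPlus ↔ P.rgp.label x y = some (char a * star (char a)) := by
  unfold entry
  split_ifs with h1 h2
  · simp [h1]
  · simp [h2, char_ne_charPlus]
  · obtain ⟨E, hE⟩ := Option.ne_none_iff_exists'.1 h1
    rcases P.labels x y E hE with rfl | rfl
    · exact absurd hE h2
    · simp [hE]

theorem entry_ne_endRow (P : AAPlusInstance a) (x y : Fin P.n) : P.entry x y ≠ .endRow := by
  unfold entry
  split_ifs <;> simp

theorem encode_eq_matSyms (P : AAPlusInstance a) :
    P.encode = matSyms P.entry (List.finRange P.n) := rfl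

/-- There is an arc labelled `a` leaving the vertex at position `i` on the path. -/
def CharArc (a : α) (Q : RGP α V) {n : ℕ} (q : Fin (n + 1) ≃ V) (i : ℕ) : Prop :=
  ∃ (h : i + 1 < n + 1), Q.label (q ⟨i, by omega⟩) (q ⟨i + 1, h⟩) = some (char a)

theorem nHom_iff {Q : RGP α V} {n : ℕ} {q : Fin (n + 1) ≃ V}
    (hq : ∀ i j : Fin (n + 1), Q.graph.Adj (q i) (q j) ↔ (i : ℕ) + 1 = (j : ℕ))
    (hlabels : Q.LabelsAAPlus a) (P : AAPlusInstance a) :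
    P.rgp.NHom Q ↔ ∃ f : Fin P.n → ℕ, (∀ x, f x ≤ n) ∧
      (∀ x y, P.entry x y = .arcA → CharArc a Q q (f x) ∧ f y = f x + 1) ∧
      (∀ x y, P.entry x y = .arcAPlus → f x < f y) := by
  constructor
  · rintro ⟨f, hf⟩
    refine ⟨fun x => q.symm (f x), fun x => Nat.le_of_lt_succ (q.symm (f x)).2, ?_, ?_⟩
    · intro x y h
      have h1 := (exists_walk_char_iff hq hlabels _ _).1 (hf x y _ ((P.entry_eq_arcA_iff x y).1 h))
      have h2 := index_of_label hq h1
      refine ⟨⟨h2 ▸ (q.symm (f y)).2, ?_⟩, h2.symm⟩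
      simpa [h2] using h1
    · intro x y h
      exact (exists_walk_charPlus_iff hq hlabels _ _).1
        (hf x y _ ((P.entry_eq_arcAPlus_iff x y).1 h))
  · rintro ⟨f, hf, h1, h2⟩
    refine ⟨fun x => q ⟨f x, Nat.lt_succ_of_le (hf x)⟩, ?_⟩
    intro x y E hE
    rcases P.labels x y E hE with rfl | rfl
    · obtain ⟨⟨h3, h4⟩, h5⟩ := h1 x y ((P.entry_eq_arcA_iff x y).2 hE)
      refine (exists_walk_char_iff hq hlabels _ _).2 ?_
      simpa [h5] using h4
    · refine (exists_walk_charPlus_iff hq hlabels _ _).2 ?_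
      simpa using h2 x y ((P.entry_eq_arcAPlus_iff x y).2 hE)

/-- The number `min k (n + 1)` as an element of `{0, …, n + 1}`. -/
def cap (n k : ℕ) : Fin (n + 2) := ⟨min k (n + 1), by omega⟩

open Classical in
/-- Raise lower bounds for the positions of the ends of an arc; `n + 1` stands for failure. -/
noncomputable def raise (n : ℕ) (A : ℕ → Prop) :
    MatSym → Fin (n + 2) × Fin (n + 2) → Fin (n + 2) × Fin (n + 2)
  | .arcA, p =>
    -- An unusable tail position is raised by one only; repetition does the rest. Truncated
    -- subtraction at `0` is harmless under the maximum.
    (cap n (if A (max (p.1 : ℕ) ((p.2 : ℕ) - 1)) then max (p.1 : ℕ) ((p.2 : ℕ) - 1)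
      else max (p.1 : ℕ) ((p.2 : ℕ) - 1) + 1), cap n (max (p.2 : ℕ) ((p.1 : ℕ) + 1)))
  | .arcAPlus, p => (p.1, cap n (max (p.2 : ℕ) ((p.1 : ℕ) + 1)))
  | .noArc, p => p
  | .endRow, p => p

/-- The delicate coordinate is the tail of an `a`-arc. If the candidate positions differ, raising
the smaller by one does not pass the larger; if they agree, both take the same branch. -/
theorem raise_mono (n : ℕ) (A : ℕ → Prop) (c : MatSym) : Monotone (raise n A c) := by
  rintro ⟨x, y⟩ ⟨x', y'⟩ ⟨h1, h2⟩
  simp only [Fin.le_def] at h1 h2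
  cases c
  · exact ⟨h1, h2⟩
  · refine ⟨?_, ?_⟩
    · simp only [raise, cap, Fin.le_def]
      rcases Nat.lt_or_ge (max (x : ℕ) (y - 1)) (max (x' : ℕ) (y' - 1)) with h | h
      · split_ifs <;> omega
      · have : max (x : ℕ) (y - 1) = max (x' : ℕ) (y' - 1) := by omega
        rw [this]
    · simp only [raise, cap, Fin.le_def]
      omega
  · refine ⟨h1, ?_⟩
    simp only [raise, cap, Fin.le_def]
    omega
  · exact ⟨h1, h2⟩

theorem le_raise (n : ℕ) (A : ℕ → Prop) (c : MatSym) (p : Fin (n + 2) × Fin (n + 2)) :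
    p ≤ raise n A c p := by
  obtain ⟨x, y⟩ := p
  have hx := x.2
  have hy := y.2
  cases c
  · exact le_rfl
  · refine ⟨?_, ?_⟩
    · simp only [raise, cap, Fin.le_def]
      split_ifs <;> omega
    · simp only [raise, cap, Fin.le_def]
      omega
  · refine ⟨le_rfl, ?_⟩
    simp only [raise, cap, Fin.le_def]
    omega
  · exact le_rfl

/-- The bounds by `n` matter: at the top value the cap makes a pair fixed without the constraint
holding. -/
theorem raise_arcA_eq_iff {n : ℕ} {A : ℕ → Prop} {x y : Fin (n + 2)}
    (hx : (x : ℕ) ≤ n) (hy : (y : ℕ) ≤ n) :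
    raise n A .arcA (x, y) = (x, y) ↔ A x ∧ (y : ℕ) = x + 1 := by
  simp only [raise, cap, Prod.ext_iff, Fin.ext_iff]
  constructor
  · rintro ⟨h1, h2⟩
    split_ifs at h1 with h
    · have : max (x : ℕ) (y - 1) = x := by omega
      rw [this] at h
      exact ⟨h, by omega⟩
    · omega
  · rintro ⟨h1, h2⟩
    have : max (x : ℕ) (y - 1) = x := by omega
    rw [this, if_pos h1]
    omega

theorem raise_arcAPlus_eq_iff {n : ℕ} {A : ℕ → Prop} {x y : Fin (n + 2)} (hy : (y : ℕ) ≤ n) :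
    raise n A .arcAPlus (x, y) = (x, y) ↔ (x : ℕ) < y := by
  simp only [raise, cap, Prod.ext_iff, Fin.ext_iff, true_and]
  omega

/-- The machine deciding the existence of an n-homomorphism. -/
noncomputable def machine (n : ℕ) (A : ℕ → Prop) : FinTM2 where
  K := Stack
  k₀ := .inp
  k₁ := .out
  Γ := Alph (Fin (n + 2))
  Λ := Lbl
  main := .init
  σ := Reg (Fin (n + 2))
  initialState := initReg 0
  Γk₀Fin := inferInstanceAs (Fintype MatSym)
  m := prog (raise n A) 0 fun d => decide (d = Fin.last (n + 1))

theorem initList_machine (n : ℕ) (A : ℕ → Prop) (M : List MatSym) :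
    initList (machine n A) M = cfg .init 0 0 false false M [] [] [] := by
  unfold initList cfg
  congr 1
  funext k
  cases k <;> rfl

theorem haltList_machine (n : ℕ) (A : ℕ → Prop) (O : List Bool) :
    haltList (machine n A) O = ⟨none, initReg 0, stk [] [] [] [] O⟩ := by
  unfold haltList
  congr 1
  funext k
  cases k <;> rfl

theorem all_lt_last_iff_nHom {Q : RGP α V} {n : ℕ} {q : Fin (n + 1) ≃ V}
    (hq : ∀ i j : Fin (n + 1), Q.graph.Adj (q i) (q j) ↔ (i : ℕ) + 1 = (j : ℕ))
    (hlabels : Q.LabelsAAPlus a) (P : AAPlusInstance a) (v : Fin P.n → Fin (n + 2))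
    (hv : ∀ x y, raise n (CharArc a Q q) (P.entry x y) (v x, v y) = (v x, v y))
    (hmin : ∀ g : Fin P.n → Fin (n + 2),
      (∀ x y, raise n (CharArc a Q q) (P.entry x y) (g x, g y) = (g x, g y)) → v ≤ g) :
    (∀ x, v x ≠ Fin.last (n + 1)) ↔ P.rgp.NHom Q := by
  have hlast : ∀ x, v x ≠ Fin.last (n + 1) ↔ (v x : ℕ) ≤ n := fun x => by
    have := (v x).2
    rw [Ne, Fin.ext_iff, Fin.val_last]
    omega
  simp only [hlast]
  rw [nHom_iff hq hlabels]
  constructor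
  · intro h
    refine ⟨fun x => v x, h, ?_, ?_⟩
    · intro x y hxy
      have := hv x y
      rwa [hxy, raise_arcA_eq_iff (h x) (h y)] at this
    · intro x y hxy
      have := hv x y
      rwa [hxy, raise_arcAPlus_eq_iff (h y)] at this
  · rintro ⟨f, hf, h1, h2⟩ x
    refine (Fin.le_def.1 (hmin (fun x => ⟨f x, by have := hf x; omega⟩) ?_ x)).trans (hf x)
    intro x y
    cases hxy : P.entry x y
    · rfl
    · exact (raise_arcA_eq_iff (hf x) (hf y)).2 (h1 x y hxy)
    · exact (raise_arcAPlus_eq_iff (hf y)).2 (h2 x y hxy)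
    · rfl

theorem length_le_encode (P : AAPlusInstance a) : P.n ≤ P.encode.length := by
  rw [encode_eq_matSyms, length_matSyms, List.length_finRange]
  nlinarith

end AAPlusInstance

/-! ### Assembling the polynomial-time decision procedure -/

open AAPlusInstance PropagationMachine Turing in
theorem mainTheorem3 {α V : Type} (a : α) (Q : RGP α V)
    (hpath : Q.graph.IsDirectedPath) (hlabels : Q.LabelsAAPlus a) :
    SolvableInPolyTime (fun P : AAPlusInstance a => P.encode)
      (fun P : AAPlusInstance a => P.rgp.NHom Q) := by
  classical
  obtain ⟨n, q, hq⟩ := hpath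
  refine ⟨fun P => decide (P.rgp.NHom Q), fun P => decide_eq_true_iff, ⟨?_⟩⟩
  refine
    { tm := machine n (CharArc a Q q)
      inputAlphabet := Equiv.refl MatSym
      outputAlphabet := Equiv.refl Bool
      -- The potential is the sum of the bounds. Each bound is at most `n + 1`, and there are no
      -- more vertices than input symbols, so `X * (n + 1)` plays the role of `B` in `reach_answer`.
      time := (Polynomial.X * Polynomial.C (n + 1) + 2) * (5 * Polynomial.X + 4)
      outputsFun := fun P => Classical.choice ?_ }
  have hμ : StrictMono fun v : Fin P.n → Fin (n + 2) => ∑ x, (v x : ℕ) := by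
    intro v v' hlt
    obtain ⟨hle, x, hx⟩ := Pi.lt_def.1 hlt
    exact Finset.sum_lt_sum (fun x _ => hle x) ⟨x, Finset.mem_univ x, hx⟩
  have hB : ∀ v : Fin P.n → Fin (n + 2), ∑ x, (v x : ℕ) ≤ P.encode.length * (n + 1) := by
    intro v
    refine (Finset.sum_le_card_nsmul _ _ (n + 1) fun x _ => Nat.le_of_lt_succ (v x).2).trans ?_
    rw [Finset.card_univ, Fintype.card_fin, smul_eq_mul]
    exact Nat.mul_le_mul_right _ P.length_le_encode
  obtain ⟨v, h1, h2, h3⟩ := reach_answer (rev := raise n (CharArc a Q q)) (d₀ := 0)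
    (bad := fun d => decide (d = Fin.last (n + 1))) P.entry_ne_endRow (raise_mono _ _)
    (le_raise _ _) (List.nodup_finRange P.n) (List.mem_finRange) hμ hB (fun d => Fin.zero_le d)
  have hans : ((List.finRange P.n).all fun y => !decide (v y = Fin.last (n + 1))) =
      decide (P.rgp.NHom Q) := by
    rw [Bool.eq_iff_iff, List.all_eq_true, decide_eq_true_iff,
      ← all_lt_last_iff_nHom hq hlabels P v h1 h2]
    simp
  rw [hans, ← encode_eq_matSyms] at h3
  have hin : List.map (Equiv.refl MatSym).invFun P.encode = P.encode := List.map_id _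
  have htime : Polynomial.eval P.encode.length
      ((Polynomial.X * Polynomial.C (n + 1) + 2) * (5 * Polynomial.X + 4) : Polynomial ℕ) =
      (P.encode.length * (n + 1) + 2) * (5 * P.encode.length + 4) := by
    simp
  unfold TM2OutputsInTime
  rw [htime]
  erw [hin, initList_machine, Option.map_some, haltList_machine]
  exact h3
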